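/- Let $G$ and $H$ be groups. For a generating set $S$ of $G$, the marked Cayley graph of $(G,S)$ has vertex set $G$ and, for all $g\in G$ and $s\in S$, an oriented edge labelled $s$ from $g$ to $gs$; balls are centred at $1$. Say that $G$ *preforms* $H$ if there are a finite generating set $T$ of $H$ and a sequence $S_1,S_2,\dots$ of finite generating sets of $G$ with bijections $S_n\to T$ such that, for every $R\in\mathbb N$, if $n$ is large enough then the balls of radius $R$ in the marked Cayley graphs of $(G,S_n)$ and $(H,T)$ are isomorphic, as rooted oriented graphs whose labels are matched by the bijection $S_n\to T$. A group $G$ *satisfies an identity* if there is a non-trivial word $w$ in the free group on countably many generators $x_1,x_2,\dots$ such that $w(g_1,g_2,\dots)=1$ for all $g_1,g_2,\dots\in G$. A non-trivial element $w(x_1,\dots,x_k)$ of the free group $F_k$ of rank $k$ is a *$k$-almost-identity* for $G$ if $w(g_1,\dots,g_k)=1$ for all $g_1,\dots,g_k\in G$ such that $\{g_1,\dots,g_k\}$ generates $G$. The group $G$ *satisfies an almost-identity* if for every $k\ge 2$ there exists a $k$-almost-identity for $G$. **Proposition.** Let $G$ and $H$ be finitely generated groups, and suppose that $H$ is infinite.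 Then the restricted wreath product $G\wr H=G^{(H)}\rtimes H$, where $G^{(H)}$ is the group of finitely supported functions $H\to G$ on which $H$ acts by translation, preforms a non-abelian free group (that is, preforms $F_k$ for some $k\ge 2$) if and only if at least one of the following conditions holds: 1. $G$ does not satisfy any identity; 2. $H$ does not satisfy any almost-identity. -/

import Mathlib

/-- The `s`-labelled oriented edges of the marked Cayley graph of `(G, S)`:
there is an edge labelled `s ∈ S` from `g` to `g * s`. -/
def CayleyEdge {G : Type*} [Group G] (S : Set G) (s : S) (g g' : G) : Prop :=
  g' = g * (s : G)

/-- The vertices of the ball of radius `R` around `1` in the Cayley graph of `(G, S)`: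
the elements that are products of at most `R` elements of `S ∪ S⁻¹`. -/
def cayleyBall {G : Type*} [Group G] (S : Set G) (R : ℕ) : Set G :=
  {g | ∃ l : List G, l.length ≤ R ∧ (∀ x ∈ l, x ∈ S ∨ x⁻¹ ∈ S) ∧ l.prod = g}

/-- The balls of radius `R` in the marked Cayley graphs of `(G, S)` and `(H, T)` are isomorphic
as rooted graphs with oriented labelled edges, the labels being matched by the bijection `e`. -/
def CayleyBallsIso {G H : Type*} [Group G] [Group H] (S : Set G) (T : Set H) (e : S ≃ T)
    (R : ℕ) : Prop :=
  ∃ f : cayleyBall S R ≃ cayleyBall T R,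
    (∀ g : cayleyBall S R, (g : G) = 1 → (f g : H) = 1) ∧
    ∀ (s : S) (g g' : cayleyBall S R),
      CayleyEdge S s (g : G) (g' : G) ↔ CayleyEdge T (e s) (f g : H) (f g' : H)

/-- `G` preforms `H`: there are a finite generating set `T` of `H`, a sequence of finite generating
sets `S n` of `G` and bijections `S n ≃ T` such that, for every `R`, the balls of radius `R` in the
marked Cayley graphs of `(G, S n)` and `(H, T)` are isomorphic for all large `n`. -/
def Preforms (G H : Type*) [Group G] [Group H] : Prop :=
  ∃ (T : Set H) (S : ℕ → Set G) (e : ∀ n, S n ≃ T),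
    T.Finite ∧ Subgroup.closure T = ⊤ ∧
    (∀ n, (S n).Finite ∧ Subgroup.closure (S n) = ⊤) ∧
    ∀ R : ℕ, ∃ N : ℕ, ∀ n ≥ N, CayleyBallsIso (S n) T (e n) R

/-- `G` preforms a free group; here a free group is understood to be non-abelian, that is, of
finite rank at least two. -/
def PreformsFree (G : Type*) [Group G] : Prop :=
  ∃ k : ℕ, 2 ≤ k ∧ Preforms G (FreeGroup (Fin k))

/-- `G` satisfies an identity: some non-trivial word in countably many variables vanishes
under every substitution of elements of `G`. -/
def SatisfiesIdentity (G : Type*) [Group G] : Prop :=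
  ∃ w : FreeGroup ℕ, w ≠ 1 ∧ ∀ g : ℕ → G, FreeGroup.lift g w = 1

/-- `w` is a `k`-almost-identity for `G`: it is non-trivial and vanishes on every `k`-tuple whose
entries generate `G`. -/
def IsAlmostIdentity (G : Type*) [Group G] (k : ℕ) (w : FreeGroup (Fin k)) : Prop :=
  w ≠ 1 ∧ ∀ g : Fin k → G, Subgroup.closure (Set.range g) = ⊤ → FreeGroup.lift g w = 1

/-- `G` satisfies an almost-identity: it has a `k`-almost-identity for every `k ≥ 2`. (There is no
non-trivial word in zero variables, and for `k = 1` only powers of a single variable.) -/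
def SatisfiesAlmostIdentity (G : Type*) [Group G] : Prop :=
  ∀ k : ℕ, 2 ≤ k → ∃ w : FreeGroup (Fin k), IsAlmostIdentity G k w

/-- The restricted wreath product of `G` and `H`, as the subgroup of the unrestricted regular wreath
product consisting of the pairs `(f, h)` with `f : H → G` finitely supported. -/
def restrictedWreath (G H : Type*) [Group G] [Group H] : Subgroup (RegularWreathProduct G H) where
  carrier := {x | (Function.mulSupport x.left).Finite}
  one_mem' := by simp
  mul_mem' := by
    intro a b ha hb
    have hb' : (Function.mulSupport fun x => b.left (a.right⁻¹ * x)).Finite :=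
      Set.Finite.preimage (mul_right_injective a.right⁻¹).injOn hb
    exact (ha.union hb').subset (Function.mulSupport_mul _ _)
  inv_mem' := by
    intro a ha
    have h : (Function.mulSupport fun x => a.left (a.right * x)).Finite :=
      Set.Finite.preimage (mul_right_injective a.right).injOn ha
    refine h.subset ?_
    intro x hx
    simpa using hx

/-! For any group `W`, preforming a non-abelian free group means having no almost-identity
(`preformsFree_iff`). In one direction, finitely many non-trivial words in a free group have a
common non-trivial consequence (`FreeGroup.exists_mem_normalClosure`); in the other, finitely many
relations witness that a tuple generates. It remains to study almost-identities of the wreath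
product.

If `w` is an almost-identity of `H`, every generating tuple sends the normal closure of `w` into the
base group, a subgroup of a power of `G`. That normal closure contains a free group of infinite
rank, in which an identity of `G` can be evaluated.

Conversely, let `b₁, …, bₘ` generate the wreath product and let `w(x, y)` be a putative
almost-identity. Taking for `xᵢ` the element `bᵢ` times words in the `yⱼ` gives a generating tuple
for every choice of `y`. By `FreeGroup.exists_retraction` there are words `φᵢ(y)` with `w(φ(y), y) ≠
1`, and the `xᵢ` are made to imitate `φᵢ(y)`: in the quotient `H` if `H` has no almost-identity, or
near one place of the base, away from the supports of the `bᵢ`, if `G` has no identity. Such a place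
exists because `H` is infinite. -/

namespace FreeGroup

/-! ### Subgroups of free groups -/

theorem eq_of_commute_of {α : Type*} {i j : α} (h : Commute (of i) (of j)) : i = j := by
  classical
  by_contra hij
  -- Two generators can be sent to non-commuting transpositions in `S₃`.
  have := congrArg (lift fun k => if k = i then (Equiv.swap 0 1 : Equiv.Perm (Fin 3))
    else Equiv.swap 1 2) h.eq
  simp only [_root_.map_mul, lift_apply_of, if_true, if_neg (Ne.symm hij)] at this
  exact absurd this (by decide)

theorem exists_zpow_of_subsingleton {α : Type*} [Subsingleton α] :
    ∃ c : FreeGroup α, ∀ x : FreeGroup α, ∃ n : ℤ, c ^ n = x := by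
  rcases isEmpty_or_nonempty α with h | ⟨⟨a⟩⟩
  · exact ⟨1, fun x => ⟨0, Subsingleton.elim _ _⟩⟩
  · refine ⟨of a, fun x => ?_⟩
    induction x using FreeGroup.induction_on with
    | C1 => exact ⟨0, zpow_zero _⟩
    | of b => exact ⟨1, by rw [zpow_one, Subsingleton.elim a b]⟩
    | inv_of b _ => exact ⟨-1, by rw [zpow_neg_one, Subsingleton.elim a b]⟩
    | mul x y hx hy =>
      obtain ⟨m, rfl⟩ := hx
      obtain ⟨n, rfl⟩ := hy
      exact ⟨m + n, zpow_add _ _ _⟩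

/-- A subgroup of a free group is cyclic or contains a free group of rank two. -/
theorem cyclic_or_exists_free_two {α : Type*} (K : Subgroup (FreeGroup α)) :
    (∃ c ∈ K, ∀ x ∈ K, ∃ n : ℤ, c ^ n = x) ∨
      ∃ f : FreeGroup (Fin 2) →* FreeGroup α, Function.Injective f ∧ ∀ x, f x ∈ K := by
  -- Nielsen–Schreier: `K` is itself free, so only the size of a basis matters.
  let e := IsFreeGroup.toFreeGroup K
  rcases subsingleton_or_nontrivial (IsFreeGroup.Generators K) with h | ⟨a, b, hab⟩
  · obtain ⟨c, hc⟩ := exists_zpow_of_subsingleton (α := IsFreeGroup.Generators K)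
    refine Or.inl ⟨e.symm c, (e.symm c).2, fun x hx => ?_⟩
    obtain ⟨n, hn⟩ := hc (e ⟨x, hx⟩)
    refine ⟨n, ?_⟩
    have : e.symm c ^ n = ⟨x, hx⟩ := by rw [← map_zpow, hn, e.symm_apply_apply]
    simpa using congrArg Subtype.val this
  · right
    have hinj : Function.Injective ![a, b] := by
      intro i j hij
      fin_cases i <;> fin_cases j <;> simp_all [eq_comm]
    exact ⟨K.subtype.comp (e.symm.toMonoidHom.comp (FreeGroup.map ![a, b])),
      K.subtype_injective.comp (e.symm.injective.comp (FreeGroup.map_injective hinj)),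
      fun x => SetLike.coe_mem _⟩

/-- The two elements generate an abelian subgroup, which contains no free group of rank two and is
therefore cyclic. -/
theorem exists_zpow_eq_zpow_of_commute {α : Type*} {x y : FreeGroup α} (hx : x ≠ 1) (hy : y ≠ 1)
    (h : Commute x y) : ∃ m n : ℤ, m ≠ 0 ∧ n ≠ 0 ∧ x ^ m = y ^ n := by
  have hcomm : ∀ u ∈ Subgroup.closure {x, y}, ∀ v ∈ Subgroup.closure {x, y}, Commute u v := by
    have hg : ∀ u ∈ ({x, y} : Set (FreeGroup α)), ∀ v ∈ ({x, y} : Set (FreeGroup α)),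
        u * v = v * u := by
      rintro u (rfl | rfl) v (rfl | rfl)
      exacts [rfl, h.eq, h.eq.symm, rfl]
    intro u hu v hv
    have := (Subgroup.isMulCommutative_closure hg).is_comm.comm ⟨u, hu⟩ ⟨v, hv⟩
    exact congrArg Subtype.val this
  rcases cyclic_or_exists_free_two (Subgroup.closure {x, y}) with ⟨c, -, hc⟩ | ⟨f, hf, hfK⟩
  · obtain ⟨n, rfl⟩ := hc x (Subgroup.subset_closure (by simp))
    obtain ⟨m, rfl⟩ := hc y (Subgroup.subset_closure (by simp))
    refine ⟨m, n, ?_, ?_, by rw [← zpow_mul, ← zpow_mul, mul_comm]⟩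
    · rintro rfl
      exact hy (zpow_zero _)
    · rintro rfl
      exact hx (zpow_zero _)
  · have : Commute (of (0 : Fin 2)) (of 1) := by
      apply hf
      simpa using (hcomm _ (hfK (of 0)) _ (hfK (of 1))).eq
    exact absurd (eq_of_commute_of this) (by decide)

/-- Normal subgroups meeting trivially commute elementwise, and commuting non-trivial elements share
a non-trivial power. -/
theorem inf_ne_bot_of_normal {α : Type*} {M N : Subgroup (FreeGroup α)} [M.Normal] [N.Normal]
    (hM : M ≠ ⊥) (hN : N ≠ ⊥) : M ⊓ N ≠ ⊥ := by
  obtain ⟨x, hxM, hx⟩ := (Subgroup.bot_or_exists_ne_one M).resolve_left hM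
  obtain ⟨y, hyN, hy⟩ := (Subgroup.bot_or_exists_ne_one N).resolve_left hN
  intro hbot
  have hxy : Commute x y := Subgroup.commute_of_normal_of_disjoint M N inferInstance inferInstance
    (disjoint_iff.2 hbot) x y hxM hyN
  obtain ⟨m, n, hm, -, hmn⟩ :=
    exists_zpow_eq_zpow_of_commute hx hy hxy
  have : x ^ m ∈ M ⊓ N := ⟨M.zpow_mem hxM m, hmn ▸ N.zpow_mem hyN n⟩
  rw [hbot, Subgroup.mem_bot] at this
  exact hx ((IsMulTorsionFree.zpow_eq_one_iff_left hm).1 this)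

/-- Finitely many non-trivial elements of a free group have normal closures with non-trivial
intersection. -/
theorem exists_mem_normalClosure {α : Type*} [Nonempty α] (s : Finset (FreeGroup α))
    (hs : (1 : FreeGroup α) ∉ s) :
    ∃ w : FreeGroup α, w ≠ 1 ∧ ∀ u ∈ s, w ∈ Subgroup.normalClosure {u} := by
  classical
  suffices (s.inf fun u => Subgroup.normalClosure {u}) ≠ ⊥ by
    obtain ⟨x, hxs, hx⟩ := (Subgroup.bot_or_exists_ne_one _).resolve_left this
    exact ⟨x, hx, fun u hu => Finset.inf_le (f := fun u => Subgroup.normalClosure {u}) hu hxs⟩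
  have key : ∀ s : Finset (FreeGroup α), 1 ∉ s →
      (s.inf fun u => Subgroup.normalClosure {u}).Normal ∧
        (s.inf fun u => Subgroup.normalClosure {u}) ≠ ⊥ := by
    intro s
    induction s using Finset.induction_on with
    | empty =>
      intro _
      rw [Finset.inf_empty]
      obtain ⟨a⟩ := ‹Nonempty α›
      exact ⟨inferInstance, fun h => of_ne_one a (Subgroup.mem_bot.1 (h ▸ Subgroup.mem_top _))⟩
    | insert u s hu ih =>
      intro h1
      rw [Finset.mem_insert, not_or] at h1
      obtain ⟨hn, hb⟩ := ih h1.2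
      rw [Finset.inf_insert]
      refine ⟨Subgroup.normal_inf_normal _ _, inf_ne_bot_of_normal ?_ hb⟩
      intro h
      exact h1.1 (Subgroup.mem_bot.1 (h ▸ Subgroup.subset_normalClosure (Set.mem_singleton u))).symm
  exact (key s hs).2

/-- Otherwise the subgroup is generated by some `c`. Conjugation by a basis element `a` acts on it
by a sign, so `a ^ 2` commutes with `c` and has a power in common with it. Two basis elements would
then have a common power, which abelianisation forbids. -/
theorem exists_free_two_le_of_normal {α : Type*} [Nontrivial α] {N : Subgroup (FreeGroup α)}
    [hN : N.Normal] (hbot : N ≠ ⊥) :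
    ∃ f : FreeGroup (Fin 2) →* FreeGroup α, Function.Injective f ∧ ∀ x, f x ∈ N := by
  classical
  refine (cyclic_or_exists_free_two N).resolve_left ?_
  rintro ⟨c, hcN, hc⟩
  have hc1 : c ≠ 1 := by
    rintro rfl
    refine hbot ((Subgroup.eq_bot_iff_forall _).2 fun x hx => ?_)
    obtain ⟨n, rfl⟩ := hc x hx
    exact one_zpow n
  have hinj : ∀ {m n : ℤ}, c ^ m = c ^ n → m = n := by
    intro m n h
    by_contra hmn
    refine hc1 ((IsMulTorsionFree.zpow_eq_one_iff_left (sub_ne_zero.2 hmn)).1 ?_)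
    rw [zpow_sub, h, mul_inv_cancel]
  have hsq : ∀ a : α, ∃ m n : ℤ, m ≠ 0 ∧ n ≠ 0 ∧ (of a * of a) ^ m = c ^ n := by
    intro a
    have hne : of a * of a ≠ 1 := by
      rw [← _root_.sq]
      exact fun h => of_ne_one a (sq_eq_one.1 h)
    refine exists_zpow_eq_zpow_of_commute hne hc1 ?_
    obtain ⟨m, hm⟩ := hc _ (hN.conj_mem c hcN (of a))
    obtain ⟨l, hl⟩ := hc _ (hN.conj_mem c hcN (of a)⁻¹)
    have hml : m * l = 1 := by
      apply hinj
      rw [zpow_one, zpow_mul, hm, conj_zpow, hl]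
      group
    have hmm : m * m = 1 := by
      rcases Int.mul_eq_one_iff_eq_one_or_neg_one.1 hml with h | h <;> simp [h.1]
    have h2 : of a * of a * c * (of a * of a)⁻¹ = c := by
      calc of a * of a * c * (of a * of a)⁻¹ = of a * (of a * c * (of a)⁻¹) * (of a)⁻¹ := by group
        _ = c ^ (m * m) := by rw [← hm, ← conj_zpow, ← hm, ← zpow_mul]
        _ = c := by rw [hmm, zpow_one]
    exact mul_inv_eq_iff_eq_mul.1 h2
  obtain ⟨a, b, hab⟩ := exists_pair_ne α
  obtain ⟨i, j, hi, hj, ha⟩ := hsq a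
  obtain ⟨k, l, hk, hl, hb⟩ := hsq b
  have h : (of a * of a) ^ (i * l) = (of b * of b) ^ (k * j) := by
    rw [zpow_mul, zpow_mul, ha, hb, ← zpow_mul, ← zpow_mul, mul_comm]
  have := congrArg (lift fun z => if z = a then Multiplicative.ofAdd (1 : ℤ) else 1) h
  simp only [map_zpow, _root_.map_mul, lift_apply_of, if_true, if_neg hab.symm, one_mul, one_zpow] at this
  have h2 := congrArg Multiplicative.toAdd this
  simp [hi, hl] at h2

/-- The free group of countable rank embeds in the free group of rank two. -/
theorem exists_injective_nat_two :
    ∃ f : FreeGroup ℕ →* FreeGroup (Fin 2), Function.Injective f := by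
  let shift : MulAut (FreeGroup ℤ) := freeGroupCongr (Equiv.addRight 1)
  let σ : Multiplicative ℤ →* MulAut (FreeGroup ℤ) := zpowersHom _ shift
  let ψ : FreeGroup (Fin 2) →* FreeGroup ℤ ⋊[σ] Multiplicative ℤ :=
    lift ![SemidirectProduct.inr (Multiplicative.ofAdd 1), SemidirectProduct.inl (of 0)]
  -- In `F_ℤ ⋊ ℤ`, with `ℤ` shifting the basis, these conjugates become distinct basis elements.
  let f : FreeGroup ℕ →* FreeGroup (Fin 2) := lift fun i => of 0 ^ i * of 1 * (of 0 ^ i)⁻¹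
  have hshift : ∀ i : ℕ, (shift ^ i) (of 0) = of (i : ℤ) := by
    intro i
    induction i with
    | zero => simp
    | succ i ih =>
      rw [pow_succ', MulAut.mul_apply, ih]
      simp [shift]
  have h : ψ.comp f = SemidirectProduct.inl.comp (FreeGroup.map (fun i : ℕ => (i : ℤ))) := by
    ext1 i
    simp only [MonoidHom.comp_apply, f, lift_apply_of, _root_.map_mul, _root_.map_inv, map_pow, ψ, map.of]
    simp only [Matrix.cons_val_zero, Matrix.cons_val_one]
    rw [← map_pow, ← _root_.map_inv, ← SemidirectProduct.inl_aut, ← hshift i]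
    simp [σ, ← ofAdd_nsmul]
  refine ⟨f, Function.Injective.of_comp (f := ψ) ?_⟩
  rw [← MonoidHom.coe_comp, h]
  exact SemidirectProduct.inl_injective.comp (FreeGroup.map_injective Nat.cast_injective)

end FreeGroup

/-! ### Balls in marked Cayley graphs -/

section Cayley

variable {F W : Type*} [Group F] [Group W]

theorem one_mem_cayleyBall (T : Set F) (R : ℕ) : (1 : F) ∈ cayleyBall T R :=
  ⟨[], by simp, by simp, rfl⟩

theorem inv_mem_cayleyBall {T : Set F} {R : ℕ} {g : F} (hg : g ∈ cayleyBall T R) :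
    g⁻¹ ∈ cayleyBall T R := by
  obtain ⟨l, hl, hT, rfl⟩ := hg
  refine ⟨(l.map fun x => x⁻¹).reverse, by simpa using hl, fun x hx => ?_, ?_⟩
  · simp only [List.mem_reverse, List.mem_map] at hx
    obtain ⟨y, hy, rfl⟩ := hx
    rw [inv_inv]
    exact (hT y hy).symm
  · rw [List.prod_inv_reverse]

theorem mul_mem_cayleyBall {T : Set F} {R R' : ℕ} {g g' : F} (hg : g ∈ cayleyBall T R)
    (hg' : g' ∈ cayleyBall T R') : g * g' ∈ cayleyBall T (R + R') := by
  obtain ⟨l, hl, hT, rfl⟩ := hg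
  obtain ⟨l', hl', hT', rfl⟩ := hg'
  refine ⟨l ++ l', by simpa using add_le_add hl hl', fun x hx => ?_, by simp⟩
  exact (List.mem_append.1 hx).elim (hT x) (hT' x)

theorem mem_cayleyBall_one {T : Set F} {t : F} (ht : t ∈ T) : t ∈ cayleyBall T 1 :=
  ⟨[t], by simp, by simp [ht], by simp⟩

theorem cayleyBall_mono (T : Set F) {R R' : ℕ} (h : R ≤ R') : cayleyBall T R ⊆ cayleyBall T R' :=
  fun _ ⟨l, hl, hT⟩ => ⟨l, hl.trans h, hT⟩

theorem cayleyBall_finite {T : Set F} (hT : T.Finite) (R : ℕ) : (cayleyBall T R).Finite := by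
  have : Finite {x : F | x ∈ T ∨ x⁻¹ ∈ T} := (hT.union hT.inv).subset fun x hx => hx
  refine ((List.finite_length_le {x : F | x ∈ T ∨ x⁻¹ ∈ T} R).image
    fun l => (l.map Subtype.val).prod).subset ?_
  rintro _ ⟨l, hl, hlT, rfl⟩
  lift l to List {x : F | x ∈ T ∨ x⁻¹ ∈ T} using hlT
  exact ⟨l, by simpa using hl, rfl⟩

/-- A homomorphism that is injective on a large ball identifies smaller balls. -/
theorem cayleyBallsIso_of_hom (φ : F →* W) {S : Set W} {T : Set F} (e : S ≃ T)
    (he : ∀ t : S, φ (e t) = t) {R : ℕ}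
    (hφ : ∀ x ∈ cayleyBall T (2 * R + 1), φ x = 1 → x = 1) : CayleyBallsIso S T e R := by
  have hmaps : ∀ x : cayleyBall T R, φ x ∈ cayleyBall S R := by
    rintro ⟨_, l, hl, hT, rfl⟩
    refine ⟨l.map φ, by simpa using hl, fun y hy => ?_, by rw [map_list_prod]⟩
    obtain ⟨x, hx, rfl⟩ := List.mem_map.1 hy
    have key : ∀ {t}, t ∈ T → φ t ∈ S := by
      intro t ht
      have := he (e.symm ⟨t, ht⟩)
      rw [e.apply_symm_apply] at this
      exact this ▸ (e.symm ⟨t, ht⟩).2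
    exact (hT x hx).imp key fun h => map_inv φ x ▸ key h
  -- An edge may leave the ball of radius `R`, so its end is compared inside radius `R + 1`; this
  -- accounts for `2 * R + 1`.
  have hinj : ∀ x ∈ cayleyBall T R, ∀ y ∈ cayleyBall T (R + 1), φ x = φ y → x = y := by
    intro x hx y hy hxy
    refine inv_mul_eq_one.1 (hφ _ ?_ (by rw [map_mul, map_inv, hxy, inv_mul_cancel]))
    have := mul_mem_cayleyBall (inv_mem_cayleyBall hx) hy
    rwa [← add_assoc, ← two_mul] at this
  have hbij : Function.Bijective fun x : cayleyBall T R => (⟨φ x, hmaps x⟩ : cayleyBall S R) := by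
    constructor
    · intro x y hxy
      exact Subtype.ext (hinj x x.2 y (cayleyBall_mono T (Nat.le_succ R) y.2)
        (congrArg Subtype.val hxy))
    · have key : ∀ l : List W, (∀ x ∈ l, x ∈ S ∨ x⁻¹ ∈ S) →
          ∃ l' : List F, l'.length = l.length ∧ (∀ x ∈ l', x ∈ T ∨ x⁻¹ ∈ T) ∧ l'.map φ = l := by
        intro l
        induction l with
        | nil => exact fun _ => ⟨[], rfl, by simp, rfl⟩
        | cons a l ih =>
          intro h
          obtain ⟨l', h1, h2, h3⟩ := ih fun x hx => h x (List.mem_cons_of_mem _ hx)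
          rcases h a List.mem_cons_self with ha | ha
          · exact ⟨e ⟨a, ha⟩ :: l', by simp [h1], by simpa using h2, by simp [h3, he]⟩
          · exact ⟨(e ⟨a⁻¹, ha⟩ : F)⁻¹ :: l', by simp [h1], by simpa using h2, by simp [h3, he]⟩
      rintro ⟨_, l, hl, hS, rfl⟩
      obtain ⟨l', h1, h2, rfl⟩ := key l hS
      exact ⟨⟨l'.prod, l', h1.trans_le hl, h2, rfl⟩, Subtype.ext (map_list_prod φ l')⟩
  refine ⟨(Equiv.ofBijective _ hbij).symm, ?_, ?_⟩
  · intro g hg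
    obtain ⟨x, rfl⟩ := (Equiv.ofBijective _ hbij).surjective g
    rw [Equiv.symm_apply_apply]
    refine hinj x x.2 1 (one_mem_cayleyBall _ _) ?_
    rw [map_one]
    exact hg
  · intro s g g'
    obtain ⟨x, rfl⟩ := (Equiv.ofBijective _ hbij).surjective g
    obtain ⟨x', rfl⟩ := (Equiv.ofBijective _ hbij).surjective g'
    rw [Equiv.symm_apply_apply, Equiv.symm_apply_apply]
    change φ x' = φ x * s ↔ (x' : F) = x * e s
    rw [← he s, ← map_mul]
    refine ⟨hinj _ x'.2 _ (mul_mem_cayleyBall x.2 (mem_cayleyBall_one (e s).2)), fun h => by rw [h]⟩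

/-- Isomorphic balls have the same relations of bounded length. -/
theorem CayleyBallsIso.prod_eq_one_iff {S : Set W} {T : Set F} {e : S ≃ T} {R : ℕ}
    (h : CayleyBallsIso S T e R) (l : List (S × Bool)) (hl : l.length ≤ R) :
    (l.map fun x => cond x.2 (x.1 : W) (x.1 : W)⁻¹).prod = 1 ↔
      (l.map fun x => cond x.2 (e x.1 : F) (e x.1 : F)⁻¹).prod = 1 := by
  obtain ⟨f, hf1, hf⟩ := h
  let pS : List (S × Bool) → W := fun l => (l.map fun x => cond x.2 (x.1 : W) (x.1 : W)⁻¹).prod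
  let pT : List (S × Bool) → F := fun l => (l.map fun x => cond x.2 (e x.1 : F) (e x.1 : F)⁻¹).prod
  have hmem : ∀ l : List (S × Bool), l.length ≤ R → pS l ∈ cayleyBall S R := by
    intro l hl
    refine ⟨_, by simpa using hl, fun x hx => ?_, rfl⟩
    obtain ⟨⟨s, b⟩, -, rfl⟩ := List.mem_map.1 hx
    cases b <;> simp
  -- The isomorphism follows a word edge by edge; an inverse letter is an edge from the longer
  -- prefix back to the shorter one.
  have key : ∀ (l : List (S × Bool)) (hl : l.length ≤ R), (f ⟨pS l, hmem l hl⟩ : F) = pT l := by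
    intro l
    induction l using List.reverseRecOn with
    | nil => exact fun _ => hf1 _ (by simp [pS])
    | append_singleton l a ih =>
      intro hl
      have hl' : l.length ≤ R := by
        rw [List.length_append] at hl
        omega
      have ih' := ih hl'
      obtain ⟨s, _ | _⟩ := a
      · have := (hf s ⟨_, hmem _ hl⟩ ⟨_, hmem l hl'⟩).1 (by simp [CayleyEdge, pS])
        rw [CayleyEdge, ih'] at this
        simp [pT] at this ⊢
        rw [this, mul_inv_cancel_right]
      · have := (hf s ⟨_, hmem l hl'⟩ ⟨_, hmem _ hl⟩).1 (by simp [CayleyEdge, pS])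
        rw [CayleyEdge, ih'] at this
        rw [this]
        simp [pT]
  have h1 : (f ⟨1, one_mem_cayleyBall S R⟩ : F) = 1 := hf1 _ rfl
  change pS l = 1 ↔ pT l = 1
  rw [← key l hl]
  constructor
  · intro hl1
    refine Eq.trans ?_ h1
    simp only [hl1]
  · intro hl1
    have := f.injective (Subtype.ext (hl1.trans h1.symm))
    exact congrArg Subtype.val this

theorem CayleyBallsIso.lift_eq_one_iff {S : Set W} {T : Set F} {e : S ≃ T} {R : ℕ}
    [DecidableEq T] (h : CayleyBallsIso S T e R) (r : FreeGroup T) (hr : r.toWord.length ≤ R) :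
    FreeGroup.lift (fun t => (e.symm t : W)) r = 1 ↔ FreeGroup.lift (Subtype.val : T → F) r = 1 := by
  have := h.prod_eq_one_iff (r.toWord.map fun x => (e.symm x.1, x.2)) (by simpa using hr)
  conv_lhs => rw [← FreeGroup.mk_toWord (x := r)]
  conv_rhs => rw [← FreeGroup.mk_toWord (x := r)]
  rw [FreeGroup.lift_mk, FreeGroup.lift_mk]
  simpa [Function.comp_def] using this

end Cayley

/-! ### Preforming a free group and almost-identities -/

theorem not_satisfiesAlmostIdentity_of_preformsFree {W : Type*} [Group W] (h : PreformsFree W) :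
    ¬ SatisfiesAlmostIdentity W := by
  classical
  obtain ⟨k, hk, T, S, e, hT, hTgen, hS, hball⟩ := h
  intro hAI
  obtain ⟨u, hu, hgen⟩ := hAI k hk
  let σ : ∀ n, FreeGroup T →* W := fun n => FreeGroup.lift fun t => ((e n).symm t : W)
  let τ : FreeGroup T →* FreeGroup (Fin k) := FreeGroup.lift Subtype.val
  have hστ : ∀ r, ∃ N, ∀ n ≥ N, (σ n r = 1 ↔ τ r = 1) := by
    intro r
    obtain ⟨N, hN⟩ := hball r.toWord.length
    exact ⟨N, fun n hn => (hN n hn).lift_eq_one_iff r le_rfl⟩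
  have hτ : Function.Surjective τ := by
    apply FreeGroup.lift_surjective_iff_closure_range_eq_top.2
    rwa [Subtype.range_coe]
  choose a ha using fun i => hτ (FreeGroup.of i)
  let β : FreeGroup (Fin k) →* FreeGroup T := FreeGroup.lift a
  have hτβ : ∀ x, τ (β x) = x := by
    intro x
    have : τ.comp β = MonoidHom.id _ := by
      ext1 i
      simp [β, ha]
    exact DFunLike.congr_fun this x
  have hfin : Finite T := hT
  -- `T` need not be a basis. The relation expressing `t` through the words `a i` has bounded
  -- length, so it holds in `W` for large `n`; hence the `σ n (a i)` generate `W`.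
  choose N hN using fun t : T => hστ (β t * (FreeGroup.of t)⁻¹)
  obtain ⟨M, hM⟩ := hστ (β u)
  obtain ⟨B, hB⟩ := (Set.finite_range N).bddAbove
  let n := max M B
  have hσβ : (σ n).comp β = FreeGroup.lift fun i => σ n (a i) := by
    ext1 i
    simp [β]
  have hr : (FreeGroup.lift fun i => σ n (a i)) u = 1 := by
    apply hgen
    rw [← FreeGroup.range_lift_eq_closure, ← hσβ, ← top_le_iff, ← (hS n).2, Subgroup.closure_le]
    intro s hs
    let t : T := e n ⟨s, hs⟩
    refine ⟨t, ?_⟩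
    have h1 := (hN t n ((hB ⟨t, rfl⟩).trans (le_max_right _ _))).2 (by
      rw [map_mul, map_inv, hτβ, mul_inv_eq_one]
      simp [τ])
    rw [map_mul, map_inv, mul_inv_eq_one] at h1
    rw [MonoidHom.comp_apply, h1]
    simp [σ, t]
  rw [← hσβ, MonoidHom.comp_apply, hM n (le_max_left _ _), hτβ] at hr
  exact hu hr

/-- Choose a non-trivial `w` in the normal closure of every non-trivial element of a ball. A
generating tuple on which `w` survives kills none of these elements. -/
theorem preformsFree_of_not_satisfiesAlmostIdentity {W : Type*} [Group W]
    (h : ¬ SatisfiesAlmostIdentity W) : PreformsFree W := by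
  classical
  simp only [SatisfiesAlmostIdentity, IsAlmostIdentity] at h
  push Not at h
  obtain ⟨k, hk, hw⟩ := h
  have : Nonempty (Fin k) := ⟨⟨0, by omega⟩⟩
  let T : Set (FreeGroup (Fin k)) := Set.range FreeGroup.of
  have hT : T.Finite := Set.finite_range _
  -- The radius is at least `2 * R + 1` once `n ≥ R`, and at least `2` always, which makes every
  -- tuple injective.
  have hs : ∀ n : ℕ, ∃ g : Fin k → W, Subgroup.closure (Set.range g) = ⊤ ∧
      ∀ x ∈ cayleyBall T (2 * (n + 1)), FreeGroup.lift g x = 1 → x = 1 := by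
    intro n
    obtain ⟨w, hw1, hwn⟩ := FreeGroup.exists_mem_normalClosure
      ((cayleyBall_finite hT (2 * (n + 1))).toFinset.erase 1) (by simp)
    obtain ⟨g, hg, hgw⟩ := hw w hw1
    refine ⟨g, hg, fun x hx hx1 => ?_⟩
    by_contra hne
    have := hwn x (by simp [hne, hx])
    have hle : Subgroup.normalClosure {x} ≤ (FreeGroup.lift g).ker :=
      Subgroup.normalClosure_le_normal (by simpa using hx1)
    exact hgw (hle this)
  choose g hg hinj using hs
  have hT1 : ∀ i, FreeGroup.of i ∈ cayleyBall T 1 := fun i => mem_cayleyBall_one ⟨i, rfl⟩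
  have hginj : ∀ n, Function.Injective (g n) := by
    intro n i j hij
    apply FreeGroup.of_injective
    rw [← mul_inv_eq_one]
    refine hinj n _ (cayleyBall_mono T (by omega)
      (mul_mem_cayleyBall (hT1 i) (inv_mem_cayleyBall (hT1 j)))) ?_
    simp [hij]
  refine ⟨k, hk, T, fun n => Set.range (g n), fun n => (Equiv.ofInjective _ (hginj n)).symm.trans
    (Equiv.ofInjective _ FreeGroup.of_injective), hT, FreeGroup.closure_range_of _,
    fun n => ⟨Set.finite_range _, hg n⟩, fun R => ⟨R, fun n hn => ?_⟩⟩
  refine cayleyBallsIso_of_hom (FreeGroup.lift (g n)) _ ?_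
    fun x hx => hinj n x (cayleyBall_mono T (by omega) hx)
  rintro ⟨_, i, rfl⟩
  have : (Equiv.ofInjective _ (hginj n)).symm ⟨g n i, i, rfl⟩ = i :=
    Equiv.ofInjective_symm_apply (hginj n) i
  rw [Equiv.trans_apply, this, Equiv.ofInjective_apply, FreeGroup.lift_apply_of]

/-- A group preforms a free group if and only if it satisfies no almost-identity. -/
theorem preformsFree_iff {W : Type*} [Group W] : PreformsFree W ↔ ¬ SatisfiesAlmostIdentity W :=
  ⟨not_satisfiesAlmostIdentity_of_preformsFree, preformsFree_of_not_satisfiesAlmostIdentity⟩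

/-! ### Free groups in `SL₂` and retractions -/

/-- The transvection `u ↦ u + r * det (v, u) • v` where `v = (1, c)`. -/
def slopeTransvection {R : Type*} [CommRing R] (c : R) :
    Multiplicative R →* Matrix.SpecialLinearGroup (Fin 2) R where
  toFun r := ⟨!![1 - c * r.toAdd, r.toAdd; -(c ^ 2 * r.toAdd), 1 + c * r.toAdd], by
    rw [Matrix.det_fin_two_of]; ring⟩
  map_one' := by ext i j; fin_cases i <;> fin_cases j <;> simp
  map_mul' r s := by
    have key : ∀ a b : R, !![1 - c * (a + b), a + b; -(c ^ 2 * (a + b)), 1 + c * (a + b)] =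
        !![1 - c * a, a; -(c ^ 2 * a), 1 + c * a] * !![1 - c * b, b; -(c ^ 2 * b), 1 + c * b] := by
      intro a b
      rw [Matrix.mul_fin_two]
      ext i j
      fin_cases i <;> fin_cases j <;> simp <;> ring
    exact Subtype.ext (key r.toAdd s.toAdd)

theorem coe_slopeTransvection {R : Type*} [CommRing R] (c r : R) :
    (slopeTransvection c (Multiplicative.ofAdd r)).1 =
      !![1 - c * r, r; -(c ^ 2 * r), 1 + c * r] := rfl

section PingPong

open Polynomial

/-- The vectors of integer polynomials whose leading coefficient is a multiple of `(1, c)`. -/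
def leadingSlope (c : ℤ) : Set (Fin 2 → ℤ[X]) :=
  {u | ∃ (d : ℕ) (l : ℤ), l ≠ 0 ∧ (∀ i, (u i).natDegree ≤ d) ∧
    (u 0).coeff d = l ∧ (u 1).coeff d = c * l}

theorem leadingSlope_disjoint {c c' : ℤ} (h : c ≠ c') :
    Disjoint (leadingSlope c) (leadingSlope c') := by
  rw [Set.disjoint_left]
  rintro u ⟨d, l, hl, hd, h0, h1⟩ ⟨d', l', hl', hd', h0', h1'⟩
  rcases lt_trichotomy d d' with hlt | rfl | hlt
  · exact hl' (h0' ▸ coeff_eq_zero_of_natDegree_lt ((hd 0).trans_lt hlt))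
  · rw [h0] at h0'
    subst h0'
    rw [h1] at h1'
    exact h (mul_right_cancel₀ hl h1')
  · exact hl (h0 ▸ coeff_eq_zero_of_natDegree_lt ((hd' 0).trans_lt hlt))

/-- The vector added to `u` is `n X det(v, u) v` with `v = (1, c)`. The determinant has coefficient
`(c' - c) l ≠ 0` in degree `d`, so the added term dominates `u`. -/
theorem slopeTransvection_mulVec_mem {c c' : ℤ} (h : c ≠ c') {n : ℤ} (hn : n ≠ 0)
    {u : Fin 2 → ℤ[X]} (hu : u ∈ leadingSlope c') :
    Matrix.mulVec (slopeTransvection (C c : ℤ[X]) (Multiplicative.ofAdd (C n * X))).1 u ∈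
      leadingSlope c := by
  obtain ⟨d, l, hl, hd, h0, h1⟩ := hu
  let D : ℤ[X] := u 1 - C c * u 0
  have hDdeg : D.natDegree ≤ d := by
    refine (natDegree_sub_le _ _).trans (max_le (hd 1) ?_)
    exact (natDegree_C_mul_le _ _).trans (hd 0)
  have hDd : D.coeff d = (c' - c) * l := by
    simp [D, h0, h1, sub_mul]
  have hu0 : Matrix.mulVec (slopeTransvection (C c : ℤ[X])
      (Multiplicative.ofAdd (C n * X))).1 u 0 = u 0 + C n * (D * X) := by
    rw [coe_slopeTransvection]
    simp [Matrix.mulVec, dotProduct, Fin.sum_univ_two, D]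
    ring
  have hu1 : Matrix.mulVec (slopeTransvection (C c : ℤ[X])
      (Multiplicative.ofAdd (C n * X))).1 u 1 = u 1 + C c * (C n * (D * X)) := by
    rw [coe_slopeTransvection]
    simp [Matrix.mulVec, dotProduct, Fin.sum_univ_two, D]
    ring
  have hdeg : (C n * (D * X)).natDegree ≤ d + 1 :=
    (natDegree_C_mul_le _ _).trans (natDegree_mul_le_of_le hDdeg natDegree_X_le)
  refine ⟨d + 1, n * ((c' - c) * l), ?_, ?_, ?_, ?_⟩
  · exact mul_ne_zero hn (mul_ne_zero (sub_ne_zero.2 h.symm) hl)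
  · intro i
    fin_cases i
    · refine (congrArg natDegree hu0).trans_le (natDegree_add_le_of_degree_le ?_ hdeg)
      exact (hd 0).trans (Nat.le_succ d)
    · refine (congrArg natDegree hu1).trans_le (natDegree_add_le_of_degree_le ?_ ?_)
      · exact (hd 1).trans (Nat.le_succ d)
      · exact (natDegree_C_mul_le _ _).trans hdeg
  · rw [hu0, coeff_add, coeff_eq_zero_of_natDegree_lt ((hd 0).trans_lt (Nat.lt_succ_self d)),
      coeff_C_mul, coeff_mul_X, hDd, zero_add]
  · rw [hu1, coeff_add, coeff_eq_zero_of_natDegree_lt ((hd 1).trans_lt (Nat.lt_succ_self d)),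
      coeff_C_mul, coeff_C_mul, coeff_mul_X, hDd, zero_add]

/-- The transvections with pairwise distinct integral slopes and parameter `X` generate a free
subgroup of `SL₂(ℤ[X])`. -/
theorem injective_lift_slopeTransvection {ι : Type} [Nontrivial ι] {c : ι → ℤ}
    (hc : Function.Injective c) :
    Function.Injective (FreeGroup.lift fun i =>
      slopeTransvection (C (c i) : ℤ[X]) (Multiplicative.ofAdd X)) := by
  let f : ι → FreeGroup Unit →* Matrix.SpecialLinearGroup (Fin 2) ℤ[X] := fun i =>
    FreeGroup.lift fun _ => slopeTransvection (C (c i) : ℤ[X]) (Multiplicative.ofAdd X)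
  have hf : (FreeGroup.lift fun i =>
      slopeTransvection (C (c i) : ℤ[X]) (Multiplicative.ofAdd X)) =
      (Monoid.CoprodI.lift f).comp (freeGroupEquivCoprodI (ι := ι)).toMonoidHom := by
    ext1 i
    simp [f]
  rw [hf, MonoidHom.coe_comp]
  refine Function.Injective.comp ?_ freeGroupEquivCoprodI.injective
  let A : MulAction (Matrix.SpecialLinearGroup (Fin 2) ℤ[X]) (Fin 2 → ℤ[X]) :=
    { smul := fun M u => Matrix.mulVec M.1 u
      one_smul := fun u => Matrix.one_mulVec u
      mul_smul := fun M N u => (Matrix.mulVec_mulVec u M.1 N.1).symm }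
  refine Monoid.CoprodI.lift_injective_of_ping_pong f ?_ (fun i => leadingSlope (c i)) ?_ ?_ ?_
  -- Ping-pong needs three factors or a factor with at least three elements; here the factors are
  -- infinite cyclic.
  · right
    obtain ⟨i⟩ := (inferInstance : Nonempty ι)
    refine ⟨i, ?_⟩
    have : Infinite (FreeGroup Unit) := FreeGroup.freeGroupUnitEquivInt.infinite_iff.2 inferInstance
    exact Cardinal.ofNat_le_aleph0.trans (Cardinal.aleph0_le_mk _)
  · intro i
    exact ⟨![1, C (c i)], 0, 1, one_ne_zero, fun j => by fin_cases j <;> simp, by simp, by simp⟩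
  · intro i j hij
    exact leadingSlope_disjoint (hc.ne hij)
  · rintro i j hij h hne _ ⟨u, hu, rfl⟩
    obtain ⟨n, rfl⟩ : ∃ n : ℤ, FreeGroup.of () ^ n = h := by
      refine ⟨FreeGroup.freeGroupUnitEquivInt h, ?_⟩
      exact FreeGroup.freeGroupUnitEquivInt.symm_apply_apply h
    have hn : n ≠ 0 := by
      rintro rfl
      exact hne (zpow_zero _)
    have := slopeTransvection_mulVec_mem (hc.ne hij) hn hu
    have h2 : f i (FreeGroup.of () ^ n) =
        slopeTransvection (C (c i) : ℤ[X]) (Multiplicative.ofAdd (C n * X)) := by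
      simp only [f, map_zpow, FreeGroup.lift_apply_of]
      rw [← map_zpow, ← ofAdd_zsmul]
      simp
    change Matrix.mulVec (f i (FreeGroup.of () ^ n)).1 u ∈ leadingSlope (c i)
    rwa [h2]

end PingPong

/-- Over a prime field, two transvections with slopes `0` and `1` generate `SL₂`. -/
theorem closure_slopeTransvection {p : ℕ} [Fact p.Prime] {t : ZMod p} (ht : t ≠ 0)
    {K : Subgroup (Matrix.SpecialLinearGroup (Fin 2) (ZMod p))}
    (h0 : slopeTransvection 0 (Multiplicative.ofAdd t) ∈ K)
    (h1 : slopeTransvection 1 (Multiplicative.ofAdd t) ∈ K) : K = ⊤ := by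
  have hall : ∀ c : ZMod p, slopeTransvection c (Multiplicative.ofAdd t) ∈ K →
      ∀ r, slopeTransvection c (Multiplicative.ofAdd r) ∈ K := by
    intro c hc r
    -- Natural multiples of `t ≠ 0` exhaust the prime field.
    have := K.pow_mem hc (r / t).val
    rw [← map_pow, ← ofAdd_nsmul, nsmul_eq_mul, ZMod.natCast_zmod_val, div_mul_cancel₀ r ht] at this
    exact this
  let U : ZMod p → Matrix.SpecialLinearGroup (Fin 2) (ZMod p) := fun r =>
    slopeTransvection 0 (Multiplicative.ofAdd r)
  -- `U (-1)` moves the direction `(1, 1)` to `(0, 1)`, so this conjugate is lower triangular.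
  let V : ZMod p → Matrix.SpecialLinearGroup (Fin 2) (ZMod p) := fun r =>
    U (-1) * slopeTransvection 1 (Multiplicative.ofAdd (-r)) * U 1
  have hU : ∀ r, U r ∈ K := hall 0 h0
  have hV : ∀ r, V r ∈ K := fun r => K.mul_mem (K.mul_mem (hU _) (hall 1 h1 _)) (hU _)
  have hUval : ∀ r, (U r).1 = !![1, r; 0, 1] := by
    intro r
    simp [U, coe_slopeTransvection]
  have hVval : ∀ r, (V r).1 = !![1, 0; r, 1] := by
    intro r
    simp only [V, Matrix.SpecialLinearGroup.coe_mul, hUval, coe_slopeTransvection,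
      Matrix.mul_fin_two]
    ext i j
    fin_cases i <;> fin_cases j <;> simp
  have key : ∀ M : Matrix.SpecialLinearGroup (Fin 2) (ZMod p), M.1 1 0 ≠ 0 → M ∈ K := by
    intro M hM
    have hdet := M.2
    rw [Matrix.det_fin_two] at hdet
    have : M = U ((M.1 0 0 - 1) / M.1 1 0) * V (M.1 1 0) * U ((M.1 1 1 - 1) / M.1 1 0) := by
      apply Subtype.ext
      simp only [Matrix.SpecialLinearGroup.coe_mul, hUval, hVval]
      ext i j
      fin_cases i <;> fin_cases j <;> simp [Matrix.mul_apply, Fin.sum_univ_two] <;>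
        field_simp <;> first | ring1 | linear_combination hdet | linear_combination -hdet
    rw [this]
    exact K.mul_mem (K.mul_mem (hU _) (hV _)) (hU _)
  refine (Subgroup.eq_top_iff' K).2 fun M => ?_
  by_cases hM : M.1 1 0 = 0
  · have hdet := M.2
    rw [Matrix.det_fin_two, hM, mul_zero, sub_zero] at hdet
    refine (K.mul_mem_cancel_left (hV 1)).1 (key _ ?_)
    simp only [Matrix.SpecialLinearGroup.coe_mul, hVval]
    simp [Matrix.mul_apply, Fin.sum_univ_two, hM]
    exact left_ne_zero_of_mul_eq_one hdet
  · exact key M hM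

open Polynomial in
/-- A non-zero integer polynomial has a non-zero value modulo some prime. -/
theorem Polynomial.exists_prime_hom_ne_zero {f : ℤ[X]} (hf : f ≠ 0) :
    ∃ p : ℕ, p.Prime ∧ ∃ φ : ℤ[X] →+* ZMod p, φ f ≠ 0 := by
  obtain ⟨n, hn⟩ : ∃ n : ℤ, f.eval n ≠ 0 := by
    by_contra! h
    exact hf (Polynomial.funext fun n => by simp [h n])
  obtain ⟨p, hle, hp⟩ := Nat.exists_infinite_primes ((f.eval n).natAbs + 1)
  refine ⟨p, hp, (Int.castRingHom (ZMod p)).comp (evalRingHom n), ?_⟩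
  simp only [RingHom.comp_apply, coe_evalRingHom, eq_intCast, ne_eq]
  rw [ZMod.intCast_zmod_eq_zero_iff_dvd]
  intro hdvd
  have := Nat.le_of_dvd (Int.natAbs_pos.2 hn) (Int.natCast_dvd.1 hdvd)
  omega

open Polynomial in
/-- A non-trivial element of `F_m * F_r` survives under some retraction onto `F_r`, if `r ≥ 2`. -/
theorem FreeGroup.exists_retraction {m r : ℕ} (hr : 2 ≤ r) {w : FreeGroup (Fin m ⊕ Fin r)}
    (hw : w ≠ 1) : ∃ φ : Fin m → FreeGroup (Fin r), lift (Sum.elim φ of) w ≠ 1 := by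
  let y0 : Fin r := ⟨0, by omega⟩
  let y1 : Fin r := ⟨1, by omega⟩
  -- Slopes `0` and `1` go to `y0` and `y1`, which will generate `SL₂`; negative slopes keep the
  -- others distinct from them.
  let c : Fin m ⊕ Fin r → ℤ := Sum.elim (fun i => -(i + 1 : ℤ)) fun j => j
  have hc : Function.Injective c := by
    rintro (i | i) (j | j) h
    · simp only [c, Sum.elim_inl] at h
      exact congrArg Sum.inl (Fin.ext (by omega))
    · simp only [c, Sum.elim_inl, Sum.elim_inr] at h
      omega
    · simp only [c, Sum.elim_inl, Sum.elim_inr] at h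
      omega
    · simp only [c, Sum.elim_inr] at h
      exact congrArg Sum.inr (Fin.ext (by omega))
  have : Nontrivial (Fin m ⊕ Fin r) := ⟨Sum.inr y0, Sum.inr y1, by simp [y0, y1]⟩
  let ψ : FreeGroup (Fin m ⊕ Fin r) →* Matrix.SpecialLinearGroup (Fin 2) ℤ[X] :=
    lift fun i => slopeTransvection (C (c i) : ℤ[X]) (Multiplicative.ofAdd X)
  have hψ : ψ w ≠ 1 := fun h =>
    hw (injective_lift_slopeTransvection hc (h.trans (_root_.map_one ψ).symm))
  obtain ⟨i, j, hij⟩ : ∃ i j, (ψ w).1 i j - (1 : Matrix (Fin 2) (Fin 2) ℤ[X]) i j ≠ 0 := by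
    by_contra! h
    refine hψ (Subtype.ext (Matrix.ext fun i j => ?_))
    exact sub_eq_zero.1 (h i j)
  -- The factor `X` ensures that the transvection parameter `θ X` is also non-zero.
  obtain ⟨p, hp, θ, hθ⟩ := Polynomial.exists_prime_hom_ne_zero (mul_ne_zero hij X_ne_zero)
  have : Fact p.Prime := ⟨hp⟩
  rw [_root_.map_mul] at hθ
  let Ψ : FreeGroup (Fin m ⊕ Fin r) →* Matrix.SpecialLinearGroup (Fin 2) (ZMod p) :=
    (Matrix.SpecialLinearGroup.map θ).comp ψ
  have hΨof : ∀ a, Ψ (of a) =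
      slopeTransvection (c a : ZMod p) (Multiplicative.ofAdd (θ X)) := by
    intro a
    apply Subtype.ext
    simp only [Ψ, ψ, MonoidHom.comp_apply, lift_apply_of, Matrix.SpecialLinearGroup.map_apply_coe,
      coe_slopeTransvection]
    ext i j
    fin_cases i <;> fin_cases j <;> simp
  have hΨ : Ψ w ≠ 1 := by
    intro h
    apply left_ne_zero_of_mul hθ
    have := congrArg (fun M : Matrix.SpecialLinearGroup (Fin 2) (ZMod p) => M.1 i j) h
    simp only [Ψ, MonoidHom.comp_apply, Matrix.SpecialLinearGroup.map_apply_coe,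
      RingHom.mapMatrix_apply, Matrix.map_apply, Matrix.SpecialLinearGroup.coe_one] at this
    rw [map_sub, this, sub_eq_zero, Matrix.one_apply, Matrix.one_apply]
    split_ifs <;> simp
  have hsurj : (Ψ.comp (FreeGroup.map Sum.inr : FreeGroup (Fin r) →* _)).range = ⊤ := by
    refine closure_slopeTransvection (right_ne_zero_of_mul hθ) ⟨of y0, ?_⟩ ⟨of y1, ?_⟩
    · rw [MonoidHom.comp_apply, map.of, hΨof]
      simp [c, y0]
    · rw [MonoidHom.comp_apply, map.of, hΨof]
      simp [c, y1]
  -- The `y`-variables already fill `SL₂`, so each `x` can be replaced by a word in them without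
  -- changing the image of `w`.
  choose φ hφ using fun x : Fin m => MonoidHom.range_eq_top.1 hsurj (Ψ (of (Sum.inl x)))
  refine ⟨φ, fun h => hΨ ?_⟩
  have hcomp : (Ψ.comp (FreeGroup.map Sum.inr)).comp (lift (Sum.elim φ of)) = Ψ := by
    ext1 a
    rcases a with x | y
    · simpa using hφ x
    · simp
  rw [← hcomp, MonoidHom.comp_apply, h, _root_.map_one]

/-! ### Generating tuples -/

theorem closure_range_eq_top_of_mem {A F W : Type*} [Group F] [Group W] {b : A → W} (f : F →* W)
    (hb : Subgroup.closure (Set.range b) = ⊤) (h : ∀ x, b x ∈ f.range) : f.range = ⊤ := by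
  rw [← top_le_iff, ← hb, Subgroup.closure_le]
  rintro _ ⟨x, rfl⟩
  exact h x

theorem Group.FG.exists_generating_tuple (W : Type*) [Group W] [Group.FG W] :
    ∃ (m : ℕ) (b : Fin m → W), Subgroup.closure (Set.range b) = ⊤ := by
  obtain ⟨s, hs, hfin⟩ := Group.fg_iff.1 ‹Group.FG W›
  have := hfin.fintype
  refine ⟨Fintype.card s, fun i => (Fintype.equivFin s).symm i, ?_⟩
  rw [← hs]
  congr 1
  exact ((Fintype.equivFin s).symm.surjective.range_comp Subtype.val).trans Subtype.range_coe

/-- Almost-identities are transported along bijections of the set of variables. -/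
theorem SatisfiesAlmostIdentity.exists_sum {W : Type*} [Group W] (h : SatisfiesAlmostIdentity W)
    {m r : ℕ} (hr : 2 ≤ r) :
    ∃ w : FreeGroup (Fin m ⊕ Fin r), w ≠ 1 ∧ ∀ f : FreeGroup (Fin m ⊕ Fin r) →* W,
      f.range = ⊤ → f w = 1 := by
  obtain ⟨w, hw, hg⟩ := h (m + r) (by omega)
  let e : FreeGroup (Fin (m + r)) ≃* FreeGroup (Fin m ⊕ Fin r) :=
    FreeGroup.freeGroupCongr finSumFinEquiv.symm
  refine ⟨e w, by simpa using hw, fun f hf => ?_⟩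
  have hcomp : FreeGroup.lift (fun i => f (e (FreeGroup.of i))) = f.comp e.toMonoidHom := by
    ext1 i
    simp
  have := hg (fun i => f (e (FreeGroup.of i))) (by
    rw [← FreeGroup.range_lift_eq_closure, hcomp, MonoidHom.range_eq_top]
    exact (MonoidHom.range_eq_top.1 hf).comp e.surjective)
  rw [hcomp] at this
  exact this

theorem Function.mulSupport_mulSingle_finite {G H : Type*} [Group G] [DecidableEq H] (q : H) (g : G) :
    (Function.mulSupport (Pi.mulSingle q g : H → G)).Finite :=
  (Set.finite_singleton q).subset Pi.mulSupport_mulSingle_subset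

/-! ### Almost-identities of the wreath product -/

namespace restrictedWreath

variable {G H : Type*} [Group G] [Group H]

/-- The projection of the wreath product onto the acting group. -/
def right : restrictedWreath G H →* H :=
  RegularWreathProduct.rightHom.comp (restrictedWreath G H).subtype

/-- The acting group as a subgroup of the wreath product. -/
def inl : H →* restrictedWreath G H :=
  RegularWreathProduct.inl.codRestrict _ fun h => by simp [restrictedWreath]

/-- The base element given by a finitely supported function. -/
def base (f : H → G) (hf : (Function.mulSupport f).Finite) : restrictedWreath G H :=
  ⟨⟨f, 1⟩, hf⟩

/-- The base component of an element of the wreath product. -/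
def left (x : restrictedWreath G H) : H → G := x.1.left

theorem mulSupport_left_finite (x : restrictedWreath G H) : (Function.mulSupport (left x)).Finite :=
  x.2

@[ext]
theorem ext {x y : restrictedWreath G H} (hl : left x = left y) (hr : right x = right y) : x = y :=
  Subtype.ext (RegularWreathProduct.ext hl hr)

@[simp] theorem left_one : left (1 : restrictedWreath G H) = 1 := rfl

theorem left_mul_apply (x y : restrictedWreath G H) (q : H) :
    left (x * y) q = left x q * left y ((right x)⁻¹ * q) := rfl

theorem left_inv_apply (x : restrictedWreath G H) (q : H) :
    left x⁻¹ q = (left x (right x * q))⁻¹ := rfl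

@[simp] theorem left_inl (h : H) : left (inl h : restrictedWreath G H) = 1 := rfl
@[simp] theorem right_inl (h : H) : right (inl h : restrictedWreath G H) = h := rfl
@[simp] theorem left_base (f : H → G) (hf) : left (base f hf) = f := rfl
@[simp] theorem right_base (f : H → G) (hf) : right (base f hf) = 1 := rfl

theorem right_surjective : Function.Surjective (right : restrictedWreath G H →* H) :=
  fun h => ⟨inl h, rfl⟩

/-- The copy of the base group at the place `q`. -/
def single [DecidableEq H] (q : H) : G →* restrictedWreath G H where
  toFun g := base (Pi.mulSingle q g) (Function.mulSupport_mulSingle_finite q g)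
  map_one' := by ext <;> simp
  map_mul' g g' := by
    ext x
    · simp [left_mul_apply, Pi.mulSingle_mul]
    · simp

/-- Conjugation by `H` moves the copy of `G` at `1` to every place, and these copies generate the
base. Finite generation follows. -/
theorem closure_single_inl [DecidableEq H] :
    (single (1 : H) : G →* restrictedWreath G H).range ⊔ inl.range = ⊤ := by
  set K := (single (1 : H) : G →* restrictedWreath G H).range ⊔ inl.range
  have hinl : ∀ h, inl h ∈ K := fun h => Subgroup.mem_sup_right ⟨h, rfl⟩
  have hsingle : ∀ q g, base (Pi.mulSingle q g) (Function.mulSupport_mulSingle_finite q g) ∈ K := by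
    intro q g
    have h1 : single (1 : H) g ∈ K := Subgroup.mem_sup_left ⟨g, rfl⟩
    convert K.mul_mem (K.mul_mem (hinl q) h1) (hinl q⁻¹) using 1
    ext x
    · simp [-map_inv, left_mul_apply, single, Pi.mulSingle_apply, inv_mul_eq_one, eq_comm]
    · simp [single]
  have hbase : ∀ s : Finset H, ∀ f : H → G, ∀ hf : (Function.mulSupport f).Finite,
      Function.mulSupport f ⊆ s → base f hf ∈ K := by
    intro s
    induction s using Finset.induction_on with
    | empty =>
      intro f hf hs
      have : base f hf = 1 := by
        ext x
        · have hf1 : f = 1 := by simpa using hs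
          simp [hf1]
        · simp
      rw [this]
      exact K.one_mem
    | insert q s hq ih =>
      intro f hf hs
      have hsub : Function.mulSupport (Function.update f q 1) ⊆ s := by
        intro x hx
        have hxq : x ≠ q := by
          rintro rfl
          simp at hx
        have := hs (show x ∈ Function.mulSupport f by simpa [hxq] using hx)
        simpa [hxq] using this
      have heq : base f hf = base (Pi.mulSingle q (f q)) (Function.mulSupport_mulSingle_finite q (f q)) *
          base (Function.update f q 1) (s.finite_toSet.subset hsub) := by
        ext x
        · by_cases hx : x = q
          · subst hx
            simp [left_mul_apply]
          · simp [left_mul_apply, hx]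
        · simp
      rw [heq]
      exact K.mul_mem (hsingle q _) (ih _ _ hsub)
  refine (Subgroup.eq_top_iff' K).2 fun x => ?_
  have hx : x = base (left x) (mulSupport_left_finite x) * inl (right x) := by
    ext q
    · simp [left_mul_apply]
    · simp
  rw [hx]
  exact K.mul_mem (hbase (mulSupport_left_finite x).toFinset _ _ (by simp)) (hinl _)

instance instFG [Group.FG G] [Group.FG H] : Group.FG (restrictedWreath G H) := by
  classical
  rw [Group.fg_def, ← closure_single_inl]
  exact Subgroup.FG.sup ((Group.fg_iff_subgroup_fg _).1 inferInstance)
    ((Group.fg_iff_subgroup_fg _).1 inferInstance)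

/-- Evaluation of a base component at one place, on the kernel of the projection. -/
def evalKer (q : H) : (right : restrictedWreath G H →* H).ker →* G where
  toFun x := left x.1 q
  map_one' := rfl
  map_mul' x y := by
    have hx : right x.1 = 1 := x.2
    simp [left_mul_apply, hx]

/-- The identity of `G` is evaluated inside a free subgroup of the normal closure of `w`; a
generating tuple sends it into the base, where each coordinate lies in `G`. -/
theorem satisfiesAlmostIdentity (hG : SatisfiesIdentity G) (hH : SatisfiesAlmostIdentity H) :
    SatisfiesAlmostIdentity (restrictedWreath G H) := by
  intro k hk
  obtain ⟨v, hv, hvG⟩ := hG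
  obtain ⟨w, hw, hwH⟩ := hH k hk
  have : Nontrivial (Fin k) := Fin.nontrivial_iff_two_le.2 hk
  have hN : Subgroup.normalClosure {w} ≠ ⊥ := fun h =>
    hw (Subgroup.mem_bot.1 (h ▸ Subgroup.subset_normalClosure (Set.mem_singleton w)))
  obtain ⟨f, hf, hfN⟩ := FreeGroup.exists_free_two_le_of_normal hN
  obtain ⟨j, hj⟩ := FreeGroup.exists_injective_nat_two
  refine ⟨f (j v), fun h => hv ?_, fun g hg => ?_⟩
  · exact (injective_iff_map_eq_one (f.comp j)).1 (hf.comp hj) v h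
  have hker : Subgroup.normalClosure {w} ≤ (right.comp (FreeGroup.lift g)).ker := by
    refine Subgroup.normalClosure_le_normal (Set.singleton_subset_iff.2 ?_)
    have hcomp : right.comp (FreeGroup.lift g) = FreeGroup.lift fun i => right (g i) := by
      ext1 i
      simp
    change right.comp (FreeGroup.lift g) w = 1
    rw [hcomp]
    apply hwH
    rw [← FreeGroup.range_lift_eq_closure, ← hcomp, MonoidHom.range_eq_top]
    refine right_surjective.comp (MonoidHom.range_eq_top.1 ?_)
    rw [FreeGroup.range_lift_eq_closure, hg]
  let θ : FreeGroup ℕ →* (right : restrictedWreath G H →* H).ker :=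
    ((FreeGroup.lift g).comp (f.comp j)).codRestrict _ fun x => hker (hfN (j x))
  have hθ : ∀ q, evalKer q (θ v) = 1 := by
    intro q
    have : (evalKer q).comp θ = FreeGroup.lift fun i => evalKer q (θ (FreeGroup.of i)) := by
      ext1 i
      simp
    rw [← MonoidHom.comp_apply, this]
    exact hvG _
  change ((θ v : (right : restrictedWreath G H →* H).ker) : restrictedWreath G H) = 1
  ext q
  · exact hθ q
  · exact (θ v).2

theorem not_satisfiesAlmostIdentity_of_right [Group.FG G] [Group.FG H]
    (hH : ¬ SatisfiesAlmostIdentity H) : ¬ SatisfiesAlmostIdentity (restrictedWreath G H) := by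
  simp only [SatisfiesAlmostIdentity, IsAlmostIdentity] at hH
  push Not at hH
  obtain ⟨k, hk, hkH⟩ := hH
  intro hW
  obtain ⟨m, b, hb⟩ := Group.FG.exists_generating_tuple (restrictedWreath G H)
  obtain ⟨w, hw, hwW⟩ := hW.exists_sum (m := m) hk
  obtain ⟨φ, hφ⟩ := FreeGroup.exists_retraction hk hw
  obtain ⟨h, hh, hne⟩ := hkH _ hφ
  choose u hu using fun x => (MonoidHom.range_eq_top.1
    ((FreeGroup.range_lift_eq_closure (f := h)).trans hh)) (right (b x))
  let η : FreeGroup (Fin k) →* restrictedWreath G H := FreeGroup.lift fun i => inl (h i)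
  have hη : ∀ x, right (η x) = FreeGroup.lift h x := by
    intro x
    have : right.comp η = FreeGroup.lift h := by
      ext1 i
      simp [η]
    exact DFunLike.congr_fun this x
  -- The factor `(η (u x))⁻¹` cancels the projection of `b x` and `η (φ x)` installs the desired
  -- one; both lie in the subgroup generated by the `inl (h i)`, so `b x` is recovered.
  let θ : FreeGroup (Fin m ⊕ Fin k) →* restrictedWreath G H :=
    FreeGroup.lift (Sum.elim (fun x => b x * (η (u x))⁻¹ * η (φ x)) fun i => inl (h i))
  have hθη : ∀ x, η x ∈ θ.range := by
    intro x
    refine ⟨FreeGroup.map Sum.inr x, ?_⟩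
    have : θ.comp (FreeGroup.map Sum.inr) = η := by
      ext1 i
      simp [θ, η]
    exact DFunLike.congr_fun this x
  have hgen : θ.range = ⊤ := by
    refine closure_range_eq_top_of_mem θ hb fun x => ?_
    have h1 : b x * (η (u x))⁻¹ * η (φ x) ∈ θ.range :=
      ⟨FreeGroup.of (Sum.inl x), by simp [θ]⟩
    rwa [Subgroup.mul_mem_cancel_right _ (hθη _),
      Subgroup.mul_mem_cancel_right _ (inv_mem (hθη _))] at h1
  apply hne
  have hcomp : (FreeGroup.lift h).comp (FreeGroup.lift (Sum.elim φ FreeGroup.of)) =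
      right.comp θ := by
    ext1 i
    rcases i with x | i
    · simp [θ, hη, hu]
    · simp [θ]
  rw [← MonoidHom.comp_apply, hcomp, MonoidHom.comp_apply, hwW θ hgen, map_one]

/-- The base component of the value of a word at a place depends only on the base components of
the variables near this place. -/
theorem exists_finset_left_eq {A : Type*} (ρ : FreeGroup A →* H) (w : FreeGroup A) :
    ∃ D : Set H, D.Finite ∧ ∀ (θ : FreeGroup A →* restrictedWreath G H) (κ : FreeGroup A →* G)
      (V : Set H), right.comp θ = ρ →
      (∀ a, ∀ q ∈ V, left (θ (FreeGroup.of a)) q = κ (FreeGroup.of a)) →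
      ∀ z, (∀ d ∈ D, d * z ∈ V) → left (θ w) z = κ w := by
  induction w using FreeGroup.induction_on with
  | C1 => exact ⟨∅, Set.finite_empty, fun θ κ V _ _ z _ => by simp⟩
  | of a =>
    refine ⟨{1}, Set.finite_singleton 1, fun θ κ V _ h z hz => h a z ?_⟩
    simpa using hz
  | inv_of a _ =>
    refine ⟨{ρ (FreeGroup.of a)}, Set.finite_singleton _, ?_⟩
    rintro θ κ V rfl h z hz
    rw [map_inv, left_inv_apply, map_inv]
    exact congrArg Inv.inv (h a _ (hz _ rfl))
  | mul x y hx hy =>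
    obtain ⟨D, hD, hDx⟩ := hx
    obtain ⟨E, hE, hEy⟩ := hy
    refine ⟨D ∪ (fun d => d * (ρ x)⁻¹) '' E, hD.union (hE.image _), ?_⟩
    rintro θ κ V hθ h z hz
    rw [map_mul, left_mul_apply, map_mul, hDx θ κ V hθ h z fun d hd => hz d (Or.inl hd),
      hEy θ κ V hθ h _ fun d hd => ?_]
    rw [← mul_assoc]
    exact hz _ (Or.inr ⟨d, hd, by rw [← hθ]; rfl⟩)

theorem not_satisfiesAlmostIdentity_of_left [Group.FG G] [Group.FG H] [Infinite H]
    (hG : ¬ SatisfiesIdentity G) : ¬ SatisfiesAlmostIdentity (restrictedWreath G H) := by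
  classical
  simp only [SatisfiesIdentity] at hG
  push Not at hG
  intro hW
  obtain ⟨m, b, hb⟩ := Group.FG.exists_generating_tuple (restrictedWreath G H)
  obtain ⟨w, hw, hwW⟩ := hW.exists_sum (m := m) le_rfl
  obtain ⟨φ, hφ⟩ := FreeGroup.exists_retraction le_rfl hw
  obtain ⟨a, ha⟩ := hG (FreeGroup.map Fin.val (FreeGroup.lift (Sum.elim φ FreeGroup.of) w))
    fun h => hφ ((injective_iff_map_eq_one _).1 (FreeGroup.map_injective Fin.val_injective) _ h)
  let α : FreeGroup (Fin 2) →* G := FreeGroup.lift fun i => a i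
  let κ : FreeGroup (Fin m ⊕ Fin 2) →* G := α.comp (FreeGroup.lift (Sum.elim φ FreeGroup.of))
  have hκ : κ w ≠ 1 := by
    have : (FreeGroup.lift a).comp (FreeGroup.map Fin.val) = α := by
      ext1 i
      simp [α]
    rwa [← MonoidHom.comp_apply, this] at ha
  let ρ : FreeGroup (Fin m ⊕ Fin 2) →* H := FreeGroup.lift (Sum.elim (fun x => right (b x)) 1)
  -- `D` depends only on the projections to `H`. The `y`-variables will project to `1`, so `z` can
  -- be chosen before them.
  obtain ⟨D, hD, hDw⟩ := exists_finset_left_eq (G := G) ρ w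
  let B : Set H := ⋃ x, Function.mulSupport (left (b x))
  have hB : B.Finite := Set.finite_iUnion fun x => mulSupport_left_finite (b x)
  -- The translate `D z` avoids the supports of all `b x`.
  obtain ⟨z, hz⟩ := (hD.image2 (fun d q => d⁻¹ * q) hB).exists_notMem
  let V : Set H := (fun d => d * z) '' D
  have hV : V.Finite := hD.image _
  have hVB : ∀ x, ∀ q ∈ V, left (b x) q = 1 := by
    rintro x _ ⟨d, hd, rfl⟩
    by_contra hne
    exact hz ⟨d, hd, d * z, Set.mem_iUnion.2 ⟨x, hne⟩, by simp⟩
  -- In `b x * η (φ x)` the second factor is read at `(right (b x))⁻¹ * q`, so `y` must be constant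
  -- on these translates too.
  let U : Set H := V ∪ ⋃ x, (fun q => (right (b x))⁻¹ * q) '' V
  have hU : U.Finite := hV.union (Set.finite_iUnion fun x => hV.image _)
  let y : Fin 2 → restrictedWreath G H := fun i =>
    base (fun q => if q ∈ U then a i else 1) (hU.subset fun q hq => by
      by_contra h
      simp [h] at hq)
  let η : FreeGroup (Fin 2) →* restrictedWreath G H := FreeGroup.lift y
  have hηr : ∀ x, right (η x) = 1 := by
    intro x
    have : right.comp η = 1 := by
      ext1 i
      simp [η, y]
    exact DFunLike.congr_fun this x
  have hηl : ∀ x, ∀ q ∈ U, left (η x) q = α x := by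
    intro x q hq
    let ε : FreeGroup (Fin 2) →* G := (evalKer q).comp (η.codRestrict _ hηr)
    have : ε = α := by
      ext1 i
      change left (η (FreeGroup.of i)) q = _
      simp [η, y, α, hq]
    exact DFunLike.congr_fun this x
  let θ : FreeGroup (Fin m ⊕ Fin 2) →* restrictedWreath G H :=
    FreeGroup.lift (Sum.elim (fun x => b x * η (φ x)) y)
  have hinr : θ.comp (FreeGroup.map Sum.inr) = η := by
    ext1 i
    simp [θ, η]
  have hgen : θ.range = ⊤ := by
    refine closure_range_eq_top_of_mem θ hb fun x => ?_
    have h1 : b x * η (φ x) ∈ θ.range := ⟨FreeGroup.of (Sum.inl x), by simp [θ]⟩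
    have h2 : η (φ x) ∈ θ.range := by
      exact ⟨FreeGroup.map Sum.inr (φ x), DFunLike.congr_fun hinr (φ x)⟩
    rwa [Subgroup.mul_mem_cancel_right _ h2] at h1
  have hρ : right.comp θ = ρ := by
    ext1 i
    rcases i with x | i
    · simp [θ, ρ, hηr]
    · simp [θ, ρ, y]
  refine hκ ((hDw θ κ V hρ ?_ z fun d hd => ⟨d, hd, rfl⟩).symm.trans ?_)
  · rintro (x | i) q hq
    · have hq' : (right (b x))⁻¹ * q ∈ U := Or.inr (Set.mem_iUnion.2 ⟨x, q, hq, rfl⟩)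
      simp [θ, κ, left_mul_apply, hVB x q hq, hηl _ _ hq']
    · have hq' : q ∈ U := Or.inl hq
      simp [θ, κ, α, y, hq']
  · rw [hwW θ hgen, left_one, Pi.one_apply]

end restrictedWreath

theorem mainTheorem4 {G H : Type*} [Group G] [Group H] [Group.FG G] [Group.FG H] [Infinite H] :
    PreformsFree (restrictedWreath G H) ↔
      (¬ SatisfiesIdentity G ∨ ¬ SatisfiesAlmostIdentity H) := by
  rw [preformsFree_iff]
  constructor
  · intro h
    by_contra! hGH
    exact h (restrictedWreath.satisfiesAlmostIdentity hGH.1 hGH.2)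
  · rintro (h | h)
    · exact restrictedWreath.not_satisfiesAlmostIdentity_of_left h
    · exact restrictedWreath.not_satisfiesAlmostIdentity_of_right h
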